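/- Let $\mathcal{A}$ be a complex Banach algebra with identity $1$. An element $a$ of a ring $R$ with identity is *quasinilpotent* if $1+ax$ is invertible for every $x\in R$ with $xa=ax$; $a$ is *g-Drazin invertible* if there is $b\in R$ with $ab=ba$, $b=bab$ and $a-a^2b$ quasinilpotent. For $R=\mathcal{A}$ and for $R=M_2(\mathcal{A})$ such a $b$ is unique; it is called the g-Drazin inverse of $a$ and denoted $a^d$, and one writes $a^\pi=1-aa^d$. Let $A,B,C,D\in\mathcal{A}$, let $\lambda\in\mathbb{C}$ be nonzero, and let $M=\begin{pmatrix}A&B\\C&D\end{pmatrix}\in M_2(\mathcal{A})$. Suppose that $A$ and $D$ are g-Drazin invertible and that $$CA=\lambda D^\pi DC,\qquad AB=\lambda A^\pi BDD^\pi,\qquad CB=0.$$ Then $M$ is g-Drazin invertible in $M_2(\mathcal{A})$, the two series below converge unconditionally in $\mathcal{A}$, and $$M^d=\begin{pmatrix}A^d+B(D^d)^3C+\sum_{n=1}^{\infty}\sum_{k=1}^{n}A^{k-1}BD^{n-k}C(A^d)^{n+2} & B(D^d)^2\\[2pt] (D^d)^2C+\sum_{n=0}^{\infty}D^nC(A^d)^{n+2}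 & D^d\end{pmatrix}.$$ -/

import Mathlib

namespace GDrazin

/-- `a` is quasinilpotent: `1 + a x` is invertible for every `x` in the commutant of `a`. -/
def IsQuasinilpotent {R : Type*} [Ring R] (a : R) : Prop :=
  ∀ x : R, x * a = a * x → IsUnit (1 + a * x)

/-- `b` is a g-Drazin (generalized Drazin) inverse of `a`: it commutes with `a`, `b = b a b`,
and `a - a² b` is quasinilpotent. -/
structure IsGDrazinInverse {R : Type*} [Ring R] (a b : R) : Prop where
  comm : b * a = a * b
  eq_mul_mul : b = b * a * b
  quasinilpotent : IsQuasinilpotent (a - a ^ 2 * b)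

/-- `a` is g-Drazin invertible. -/
def IsGDrazinInvertible {R : Type*} [Ring R] (a : R) : Prop :=
  ∃ b : R, IsGDrazinInverse a b

open Classical in
/-- The g-Drazin inverse `a^d` of a g-Drazin invertible element `a` (with the junk value `0`
when `a` is not g-Drazin invertible). In a complex Banach algebra there is only one. -/
noncomputable def gDrazinInv {R : Type*} [Ring R] (a : R) : R :=
  if h : IsGDrazinInvertible a then h.choose else 0

/-- The spectral idempotent `a^π = 1 - a a^d`. -/
noncomputable def spectralIdempotent {R : Type*} [Ring R] (a : R) : R :=
  1 - a * gDrazinInv a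

end GDrazin

namespace GDrazin

/-! Write `α`, `δ` for the inverses of `A`, `D`. Since `D^π D` is quasinilpotent, iterating `C A = λ
D^π D C` makes `C A α = C A ^ n α ^ n` decay faster than any geometric sequence, so `C α = 0`
(`mul_eq_zero_of_intertwine`). Every term of both series contains `C α` and vanishes. What remains
is a closed-form candidate, checked directly in `isGDrazinInverse_block`. Its one hard point is
quasinilpotence of the residue, which only needs testing on scalars (`isQuasinilpotent_iff`) and
then follows from a Schur complement (`isUnit_one_add_block`). Uniqueness identifies the candidate
with `gDrazinInv`. -/

open scoped Matrix.Norms.Operator in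
theorem completeSpace_matrix {n 𝒜 : Type*} [Fintype n] [DecidableEq n] [NormedRing 𝒜]
    [CompleteSpace 𝒜] :
    @CompleteSpace (Matrix n n 𝒜) PseudoMetricSpace.toUniformSpace :=
  (inferInstance : @CompleteSpace (n → n → 𝒜) _)

/-! ### Invertibility of block matrices over a ring. -/

section Ring

variable {R : Type*} [Ring R]

theorem IsGDrazinInvertible.isGDrazinInverse_gDrazinInv {a : R} (h : IsGDrazinInvertible a) :
    IsGDrazinInverse a (gDrazinInv a) := by
  rw [gDrazinInv, dif_pos h]
  exact h.choose_spec

theorem isUnit_of_isUnit_one_sub_pow {t : R} {n : ℕ} (h : IsUnit (1 - t ^ n)) :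
    IsUnit (1 - t) := by
  have hc : Commute (1 - t) (∑ i ∈ Finset.range n, t ^ i) :=
    Commute.sum_right _ _ _ fun i _ => ((Commute.one_left _).sub_left (Commute.self_pow t i))
  rw [← mul_neg_geom_sum, hc.isUnit_mul_iff] at h
  exact h.1

/-- Here `u⁻¹ z` squares to zero, so the Neumann series stops after its linear term. -/
theorem isUnit_sub_of_mul_inv_mul_eq_zero (u : Rˣ) {z : R} (h : z * (↑u⁻¹ * z) = 0) :
    IsUnit ((u : R) - z) := by
  have h' (y : R) : z * (↑u⁻¹ * (z * y)) = 0 := by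
    rw [← mul_assoc (u⁻¹ : Rˣ).val, ← mul_assoc, h, zero_mul]
  refine ⟨⟨u - z, ↑u⁻¹ + ↑u⁻¹ * z * ↑u⁻¹, ?_, ?_⟩, rfl⟩
  · simp [mul_add, sub_mul, mul_assoc, h']
  · simp [add_mul, mul_sub, mul_assoc, h]

/-- A `2 × 2` block matrix with invertible lower right entry and invertible Schur complement is
invertible. -/
theorem isUnit_of_isUnit_schur {p b c : R} (v : Rˣ) (h : IsUnit (p - b * ↑v⁻¹ * c)) :
    IsUnit (!![p, b; c, (v : R)] : Matrix (Fin 2) (Fin 2) R) := by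
  obtain ⟨s, hs⟩ := h
  have h₁ : IsUnit (!![1, b * ↑v⁻¹; 0, 1] : Matrix (Fin 2) (Fin 2) R) :=
    ⟨⟨_, !![1, -(b * ↑v⁻¹); 0, 1], by simp [Matrix.one_fin_two], by simp [Matrix.one_fin_two]⟩,
      rfl⟩
  have h₂ : IsUnit (!![(s : R), 0; 0, (v : R)] : Matrix (Fin 2) (Fin 2) R) :=
    ⟨⟨_, !![↑s⁻¹, 0; 0, ↑v⁻¹], by simp [Matrix.one_fin_two], by simp [Matrix.one_fin_two]⟩, rfl⟩
  have h₃ : IsUnit (!![1, 0; ↑v⁻¹ * c, 1] : Matrix (Fin 2) (Fin 2) R) :=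
    ⟨⟨_, !![1, 0; -(↑v⁻¹ * c), 1], by simp [Matrix.one_fin_two], by simp [Matrix.one_fin_two]⟩,
      rfl⟩
  convert (h₁.mul h₂).mul h₃ using 1
  simp [hs, mul_assoc]

/-- The Schur complement is `u - z` with `u = 1 + a` and `z = e + b v⁻¹ c`. Moving `u⁻¹` leftwards
past `c` turns it into `w⁻¹`, and `e` absorbs it, so `z u⁻¹ z` reduces to products that all vanish.
-/
theorem isUnit_one_add_block {a b c d d' e : R} (ha : IsUnit (1 + a)) (hd : IsUnit (1 + d))
    (hd' : IsUnit (1 + d')) (hca : c * a = d' * c) (hcb : c * b = 0)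
    (hea : e * a = 0) (hee : e * e = 0) (heb : e * b = 0) (hce : c * e = 0) :
    IsUnit (1 + !![a - e, b; c, d] : Matrix (Fin 2) (Fin 2) R) := by
  obtain ⟨u, hu⟩ := ha
  obtain ⟨v, hv⟩ := hd
  obtain ⟨w, hw⟩ := hd'
  have hcu : c * ↑u⁻¹ = ↑w⁻¹ * c := by
    rw [Units.mul_inv_eq_iff_eq_mul, mul_assoc, Units.eq_inv_mul_iff_mul_eq, hu, hw, add_mul,
      mul_add, one_mul, mul_one, hca]
  have heu : e * ↑u⁻¹ = e := by
    rw [Units.mul_inv_eq_iff_eq_mul, hu, mul_add, hea, mul_one, add_zero]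
  have hz : (e + b * ↑v⁻¹ * c) * (↑u⁻¹ * (e + b * ↑v⁻¹ * c)) = 0 := by
    have hcu' : (e + b * ↑v⁻¹ * c) * ↑u⁻¹ = e + b * ↑v⁻¹ * ↑w⁻¹ * c := by
      rw [add_mul, heu, mul_assoc, hcu]
      simp only [mul_assoc]
    have h₁ (y : R) : e * (b * y) = 0 := by rw [← mul_assoc, heb, zero_mul]
    have h₂ (y : R) : c * (b * y) = 0 := by rw [← mul_assoc, hcb, zero_mul]
    rw [← mul_assoc, hcu']
    simp [add_mul, mul_add, mul_assoc, h₁, h₂, hee, hce]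
  have key := isUnit_of_isUnit_schur (p := 1 + a - e) (b := b) (c := c) v (by
    have := isUnit_sub_of_mul_inv_mul_eq_zero u hz
    rwa [hu, ← sub_sub] at this)
  convert key using 1
  simp [Matrix.one_fin_two, hv, add_sub_assoc]

end Ring

/-! ### Quasinilpotence as superexponential decay of powers. -/

section Banach

variable {𝒜 : Type*} [NormedRing 𝒜] [NormedAlgebra ℂ 𝒜] [CompleteSpace 𝒜]

/-- No nonzero scalar lies in the spectrum, so Gelfand's formula applies with spectral radius zero.
-/
theorem eventually_norm_pow_le {a : 𝒜} (h : ∀ μ : ℂ, IsUnit (1 + μ • a)) {ε : ℝ} (hε : 0 < ε) :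
    ∀ᶠ n : ℕ in Filter.atTop, ‖a ^ n‖ ≤ ε ^ n := by
  have hr : spectralRadius ℂ a = 0 := by
    refine le_antisymm (iSup₂_le fun μ hμ => ?_) bot_le
    by_cases h0 : μ = 0
    · simp [h0]
    · refine absurd ?_ hμ
      have := ((h (-μ⁻¹)).smul (Units.mk0 μ h0))
      rw [spectrum.mem_resolventSet_iff, Algebra.algebraMap_eq_smul_one]
      convert this using 1
      simp [Units.smul_def, smul_smul, h0, sub_eq_add_neg]
  have ht := spectrum.pow_norm_pow_one_div_tendsto_nhds_spectralRadius a
  rw [hr] at ht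
  filter_upwards [ht.eventually (gt_mem_nhds (ENNReal.ofReal_pos.2 hε)),
    Filter.eventually_gt_atTop 0] with n hn hn0
  have h1 := (ENNReal.ofReal_lt_ofReal_iff hε).1 hn
  calc ‖a ^ n‖ = (‖a ^ n‖ ^ (1 / n : ℝ)) ^ n := by
        rw [one_div, Real.rpow_inv_natCast_pow (norm_nonneg _) hn0.ne']
    _ ≤ ε ^ n := by gcongr

/-- In a complex Banach algebra, it is enough to test quasinilpotence on scalars. -/
theorem isQuasinilpotent_iff {a : 𝒜} :
    IsQuasinilpotent a ↔ ∀ μ : ℂ, IsUnit (1 + μ • a) := by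
  refine ⟨fun h μ => by simpa using h (μ • 1) (by simp), fun h x hx => ?_⟩
  -- Chosen so that the product with `‖x‖` is below `1`, also when `x = 0`.
  have hε : (0 : ℝ) < (2 * (‖x‖ + 1))⁻¹ := by positivity
  obtain ⟨n, hn, hn0⟩ := ((eventually_norm_pow_le h hε).and
    (Filter.eventually_gt_atTop 0)).exists
  have hc : Commute (-a) x := (show Commute a x from hx.symm).neg_left
  have key : ‖(-a * x) ^ n‖ < 1 := by
    rw [hc.mul_pow]
    calc ‖(-a) ^ n * x ^ n‖ ≤ ‖(-a) ^ n‖ * ‖x ^ n‖ := norm_mul_le _ _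
      _ ≤ (2 * (‖x‖ + 1))⁻¹ ^ n * ‖x‖ ^ n := by
        gcongr
        · rcases n.even_or_odd with h' | h' <;> simpa [h'.neg_pow] using hn
        · exact norm_pow_le' _ hn0
      _ = (‖x‖ / (2 * (‖x‖ + 1))) ^ n := by rw [← mul_pow]; ring
      _ < 1 := by
        refine pow_lt_one₀ (by positivity) ?_ hn0.ne'
        rw [div_lt_one (by positivity)]
        linarith [norm_nonneg x]
  have := isUnit_of_isUnit_one_sub_pow (isUnit_one_sub_of_norm_lt_one key)
  simpa using this

/-- The bound is asked only for `0 < n`: `‖1‖ ≤ 1` is not assumed, and an idempotent equals its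
`n`-th power only for such `n`. -/
theorem IsQuasinilpotent.eq_zero_of_norm_le {r z : 𝒜} (hr : IsQuasinilpotent r) (K L : ℝ)
    (hK : 0 ≤ K) (hL : 0 ≤ L) (h : ∀ n : ℕ, 0 < n → ‖z‖ ≤ K * ‖r ^ n‖ * L ^ n) : z = 0 := by
  have hε : (0 : ℝ) < (2 * (L + 1))⁻¹ := by positivity
  have hq : L / (2 * (L + 1)) < 1 := by
    rw [div_lt_one (by positivity)]
    linarith
  have ht := (tendsto_pow_atTop_nhds_zero_of_lt_one (by positivity) hq).const_mul K
  rw [mul_zero] at ht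
  refine norm_le_zero_iff.1 (ge_of_tendsto ht ?_)
  filter_upwards [eventually_norm_pow_le (isQuasinilpotent_iff.1 hr) hε,
    Filter.eventually_gt_atTop 0] with n hn hn0
  calc ‖z‖ ≤ K * ‖r ^ n‖ * L ^ n := h n hn0
    _ ≤ K * (2 * (L + 1))⁻¹ ^ n * L ^ n := by gcongr
    _ = K * (L / (2 * (L + 1))) ^ n := by rw [mul_assoc, ← mul_pow]; ring

theorem IsQuasinilpotent.eq_zero_of_eq_pow_mul_pow {r y z : 𝒜} (hr : IsQuasinilpotent r)
    (h : ∀ n : ℕ, 0 < n → z = r ^ n * y ^ n) : z = 0 := by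
  refine hr.eq_zero_of_norm_le 1 ‖y‖ zero_le_one (norm_nonneg _) fun n hn => ?_
  rw [one_mul]
  conv_lhs => rw [h n hn]
  exact (norm_mul_le _ _).trans (by gcongr; exact norm_pow_le' _ hn)

theorem IsQuasinilpotent.eq_zero_of_eq_pow_mul_pow' {r y z : 𝒜} (hr : IsQuasinilpotent r)
    (h : ∀ n : ℕ, 0 < n → z = y ^ n * r ^ n) : z = 0 := by
  refine hr.eq_zero_of_norm_le 1 ‖y‖ zero_le_one (norm_nonneg _) fun n hn => ?_
  rw [one_mul, mul_comm]
  conv_lhs => rw [h n hn]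
  exact (norm_mul_le _ _).trans (by gcongr; exact norm_pow_le' _ hn)

end Banach

section Inverse

variable {R : Type*} [Ring R] {a b : R}

theorem IsGDrazinInverse.isIdempotentElem (h : IsGDrazinInverse a b) :
    IsIdempotentElem (a * b) := by
  rw [IsIdempotentElem, mul_assoc, ← mul_assoc b, ← h.eq_mul_mul]

theorem IsGDrazinInverse.eq_mul_mul_self (h : IsGDrazinInverse a b) : b = a * (b * b) := by
  rw [← mul_assoc, ← h.comm, ← h.eq_mul_mul]

theorem IsGDrazinInverse.commute_one_sub (h : IsGDrazinInverse a b) :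
    Commute (1 - a * b) a :=
  (Commute.one_left a).sub_left ((Commute.refl a).mul_left h.comm)

theorem IsGDrazinInverse.sub_sq_mul (h : IsGDrazinInverse a b) :
    a - a ^ 2 * b = (1 - a * b) * a := by
  rw [sub_mul, one_mul, mul_assoc a b, h.comm, pow_two, mul_assoc]

theorem IsGDrazinInverse.sub_sq_mul_pow (h : IsGDrazinInverse a b) {n : ℕ} (hn : 0 < n) :
    (a - a ^ 2 * b) ^ n = (1 - a * b) * a ^ n := by
  rw [h.sub_sq_mul, h.commute_one_sub.mul_pow, h.isIdempotentElem.one_sub.pow_eq hn.ne']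

theorem IsGDrazinInverse.pow_mul_pow (h : IsGDrazinInverse a b) {n : ℕ} (hn : 0 < n) :
    a ^ n * b ^ n = a * b := by
  rw [← (show Commute a b from h.comm.symm).mul_pow, h.isIdempotentElem.pow_eq hn.ne']

end Inverse

/-! ### Uniqueness, and the block candidate. -/

section Unique

variable {𝒜 : Type*} [NormedRing 𝒜] [NormedAlgebra ℂ 𝒜] [CompleteSpace 𝒜]

/-- With `r` the residue of `c`, `(1 - a c) a b = r ^ n b ^ n` for all `n > 0`. With its mirror
image this makes the idempotents `a b` and `a c` coincide. -/
theorem IsGDrazinInverse.mul_eq_mul_mul {a b c : 𝒜} (hb : IsGDrazinInverse a b)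
    (hc : IsGDrazinInverse a c) : a * b = a * c * (a * b) := by
  have key : (1 - a * c) * (a * b) = 0 := by
    refine hc.quasinilpotent.eq_zero_of_eq_pow_mul_pow (y := b) fun n hn => ?_
    rw [hc.sub_sq_mul_pow hn, mul_assoc, hb.pow_mul_pow hn]
  rwa [sub_mul, one_mul, sub_eq_zero] at key

theorem IsGDrazinInverse.mul_eq_mul_mul' {a b c : 𝒜} (hb : IsGDrazinInverse a b)
    (hc : IsGDrazinInverse a c) : a * b = a * b * (a * c) := by
  have key : a * b * (1 - a * c) = 0 := by
    refine hc.quasinilpotent.eq_zero_of_eq_pow_mul_pow' (y := b) fun n hn => ?_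
    have hab : Commute a b := hb.comm.symm
    rw [hc.sub_sq_mul_pow hn, (hc.commute_one_sub.pow_right n).eq, ← mul_assoc,
      ← (hab.pow_pow n n).eq, hb.pow_mul_pow hn]
  rwa [mul_sub, mul_one, sub_eq_zero] at key

/-- In a complex Banach algebra, g-Drazin inverses are unique. -/
theorem IsGDrazinInverse.unique {a b c : 𝒜} (hb : IsGDrazinInverse a b)
    (hc : IsGDrazinInverse a c) : b = c := by
  have h : a * b = a * c := (hb.mul_eq_mul_mul hc).trans (hc.mul_eq_mul_mul' hb).symm
  calc b = b * (a * b) := by rw [← mul_assoc, ← hb.eq_mul_mul]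
    _ = a * b * c := by rw [h, ← mul_assoc, hb.comm, h]
    _ = c := by rw [h, ← hc.comm, ← hc.eq_mul_mul]

open scoped Matrix.Norms.Operator in
theorem IsGDrazinInverse.gDrazinInv_matrix_eq {n : Type*} [Fintype n] [DecidableEq n]
    {M N : Matrix n n 𝒜} (h : IsGDrazinInverse M N) : gDrazinInv M = N :=
  have := completeSpace_matrix (𝒜 := 𝒜) (n := n)
  (IsGDrazinInvertible.isGDrazinInverse_gDrazinInv ⟨N, h⟩).unique h

open scoped Matrix.Norms.Operator in
theorem isQuasinilpotent_matrix {n : Type*} [Fintype n] [DecidableEq n]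
    {M : Matrix n n 𝒜} (h : ∀ μ : ℂ, IsUnit (1 + μ • M)) : IsQuasinilpotent M :=
  have := completeSpace_matrix (𝒜 := 𝒜) (n := n)
  isQuasinilpotent_iff.2 h

/-- `c a = lam d c` with `d` quasinilpotent forces `c` to vanish on the regular part of `a`. -/
theorem IsGDrazinInverse.mul_eq_zero_of_intertwine {a b c d : 𝒜} {lam : ℂ}
    (hab : IsGDrazinInverse a b) (hd : IsQuasinilpotent d) (h : c * a = lam • (d * c)) :
    c * b = 0 := by
  have hpow (n : ℕ) : c * a ^ n = lam ^ n • (d ^ n * c) := by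
    induction n with
    | zero => simp
    | succ n ih =>
      rw [pow_succ, ← mul_assoc, ih, smul_mul_assoc, mul_assoc, h, mul_smul_comm, smul_smul,
        ← mul_assoc, ← pow_succ, ← pow_succ]
  have key : c * (a * b) = 0 := by
    refine hd.eq_zero_of_norm_le ‖c‖ (‖lam‖ * ‖b‖) (norm_nonneg _) (by positivity)
      fun n hn => ?_
    rw [← hab.pow_mul_pow hn, ← mul_assoc, hpow, smul_mul_assoc]
    calc ‖lam ^ n • (d ^ n * c * b ^ n)‖ ≤ ‖lam‖ ^ n * (‖d ^ n‖ * ‖c‖ * ‖b‖ ^ n) := by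
          rw [norm_smul, norm_pow]
          gcongr
          refine (norm_mul_le _ _).trans ?_
          gcongr
          · exact norm_mul_le _ _
          · exact norm_pow_le' _ hn
      _ = ‖c‖ * ‖d ^ n‖ * (‖lam‖ * ‖b‖) ^ n := by rw [mul_pow]; ring
  rw [hab.eq_mul_mul_self, ← mul_assoc a, ← mul_assoc, key, zero_mul]

theorem isGDrazinInverse_block {A B C D α δ : 𝒜} {lam : ℂ} (hA : IsGDrazinInverse A α)
    (hD : IsGDrazinInverse D δ) (hCA : C * A = lam • ((1 - D * δ) * D * C))
    (hAB : A * B = lam • ((1 - A * α) * B * D * (1 - D * δ))) (hCB : C * B = 0)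
    (hCα : C * α = 0) :
    IsGDrazinInverse (!![A, B; C, D] : Matrix (Fin 2) (Fin 2) 𝒜)
      !![α + B * δ ^ 3 * C, B * δ ^ 2; δ ^ 2 * C, δ] := by
  have hα := hA.eq_mul_mul_self
  have hδ := hD.eq_mul_mul_self
  have hαA := hA.comm
  have hδD := hD.comm
  have hαp : α * (1 - A * α) = 0 := by
    rw [mul_sub, mul_one, ← mul_assoc, ← hA.eq_mul_mul, sub_self]
  have hδq : δ * (1 - D * δ) = 0 := by
    rw [mul_sub, mul_one, ← mul_assoc, ← hD.eq_mul_mul, sub_self]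
  have hqδ : (1 - D * δ) * δ = 0 := by
    rw [sub_mul, one_mul, mul_assoc, ← hδ, sub_self]
  have hδCA : δ * (C * A) = 0 := by
    rw [hCA, mul_smul_comm, mul_assoc, ← mul_assoc δ, hδq, zero_mul, smul_zero]
  have hABδ : A * (B * δ) = 0 := by
    rw [← mul_assoc, hAB, smul_mul_assoc, mul_assoc, hqδ, mul_zero, smul_zero]
  have hαB : α * B = 0 := by
    have : α * (A * B) = 0 := by
      rw [hAB, mul_smul_comm, mul_assoc, mul_assoc, ← mul_assoc α, hαp, zero_mul, smul_zero]
    rw [hA.eq_mul_mul, mul_assoc α, ← hαA, mul_assoc, mul_assoc, this, mul_zero]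
  have hCB' (y : 𝒜) : C * (B * y) = 0 := by rw [← mul_assoc, hCB, zero_mul]
  have hCα' (y : 𝒜) : C * (α * y) = 0 := by rw [← mul_assoc, hCα, zero_mul]
  have hαB' (y : 𝒜) : α * (B * y) = 0 := by rw [← mul_assoc, hαB, zero_mul]
  have hABδ' (y : 𝒜) : A * (B * (δ * y)) = 0 := by
    rw [← mul_assoc, ← mul_assoc, mul_assoc A, hABδ, zero_mul]
  have hδCA' (y : 𝒜) : δ * (C * (A * y)) = 0 := by
    rw [← mul_assoc, ← mul_assoc, mul_assoc δ, hδCA, zero_mul]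
  have hδD' (y : 𝒜) : δ * (D * y) = D * (δ * y) := by rw [← mul_assoc, hδD, mul_assoc]
  have hδδ : D * (δ * δ) = δ := hδ.symm
  have hδδ' (y : 𝒜) : D * (δ * (δ * y)) = δ * y := by
    rw [← mul_assoc, ← mul_assoc, mul_assoc D, hδδ]
  have hαα : A * (α * α) = α := hα.symm
  have hCAα : C * (A * α) = 0 := by rw [← hαA, hCα']
  have hCAα' : C * (A * (A * α)) = 0 := by rw [← hαA, ← mul_assoc A, ← hαA, mul_assoc, hCα']
  refine ⟨?_, ?_, ?_⟩
  · simp [pow_succ, mul_assoc, add_mul, mul_add, hCB, hCB', hCα, hαB, hABδ',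
      hδCA, hδD, hδD', hδδ, hδδ', hαA]
  · simp [pow_succ, mul_assoc, add_mul, mul_add, hCB, hCB', hCα, hαB, hαB',
      hδCA, hδD, hδD', hδδ, hδδ', hαα, hαA]
  -- The residue has quasinilpotent diagonal, up to the square-zero correction `B δ C`.
  have hW : (!![A, B; C, D] : Matrix (Fin 2) (Fin 2) 𝒜) - !![A, B; C, D] ^ 2 *
      !![α + B * δ ^ 3 * C, B * δ ^ 2; δ ^ 2 * C, δ] =
      !![(A - A ^ 2 * α) - B * δ * C, B * (1 - D * δ); (1 - D * δ) * C, D - D ^ 2 * δ] := by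
    simp [pow_succ, mul_assoc, add_mul, mul_add, sub_mul, mul_sub, hCB, hCB', hCα,
      hABδ, hABδ', hδδ', hCAα, sub_add_eq_sub_sub]
  rw [hW]
  refine isQuasinilpotent_matrix fun μ => ?_
  have hu := isUnit_one_add_block (a := μ • (A - A ^ 2 * α)) (b := μ • (B * (1 - D * δ)))
    (c := μ • ((1 - D * δ) * C)) (d := μ • (D - D ^ 2 * δ))
    -- Passing `A` across `C` costs a factor `lam`; quasinilpotence covers this scalar too.
    (d' := (μ * lam) • (D - D ^ 2 * δ)) (e := μ • (B * δ * C))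
    (isQuasinilpotent_iff.1 hA.quasinilpotent μ) (isQuasinilpotent_iff.1 hD.quasinilpotent μ)
    (isQuasinilpotent_iff.1 hD.quasinilpotent _) ?_ ?_ ?_ ?_ ?_ ?_
  · convert hu using 2
    ext i j
    fin_cases i <;> fin_cases j <;> simp [smul_sub]
  · have h₁ : (1 - D * δ) * C * (A - A ^ 2 * α) = (1 - D * δ) * (C * A) := by
      simp [pow_two, mul_assoc, mul_sub, hCAα']
    have h₂ : (1 - D * δ) * ((1 - D * δ) * D * C) = (D - D ^ 2 * δ) * ((1 - D * δ) * C) := by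
      rw [hD.sub_sq_mul, hD.commute_one_sub.eq]
      simp only [← mul_assoc]
      rw [hD.commute_one_sub.eq]
    rw [smul_mul_smul_comm, h₁, hCA, mul_smul_comm, h₂, smul_mul_smul_comm, smul_smul]
    congr 1
    ring
  all_goals rw [smul_mul_smul_comm]
  all_goals simp [pow_succ, mul_assoc, sub_mul, mul_sub, hCB, hCB',
      hδCA, hδCA']

end Unique

end GDrazin

open GDrazin in
theorem corollary4p2 {𝒜 : Type*} [NormedRing 𝒜] [NormedAlgebra ℂ 𝒜] [CompleteSpace 𝒜]
    (A B C D : 𝒜) (lam : ℂ) (hlam : lam ≠ 0)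
    (hA : IsGDrazinInvertible A) (hD : IsGDrazinInvertible D)
    (hCA : C * A = lam • (spectralIdempotent D * D * C))
    (hAB : A * B = lam • (spectralIdempotent A * B * D * spectralIdempotent D))
    (hCB : C * B = 0) :
    IsGDrazinInvertible (!![A, B; C, D] : Matrix (Fin 2) (Fin 2) 𝒜) ∧
    Summable (fun n : ℕ => D ^ n * C * gDrazinInv A ^ (n + 2)) ∧
    Summable (fun n : ℕ => ∑ k ∈ Finset.Icc 1 n,
      A ^ (k - 1) * B * D ^ (n - k) * C * gDrazinInv A ^ (n + 2)) ∧
    gDrazinInv (!![A, B; C, D] : Matrix (Fin 2) (Fin 2) 𝒜) =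
      !![gDrazinInv A + B * gDrazinInv D ^ 3 * C
            + ∑' n : ℕ, ∑ k ∈ Finset.Icc 1 n,
                A ^ (k - 1) * B * D ^ (n - k) * C * gDrazinInv A ^ (n + 2),
          B * gDrazinInv D ^ 2;
         gDrazinInv D ^ 2 * C + ∑' n : ℕ, D ^ n * C * gDrazinInv A ^ (n + 2),
          gDrazinInv D] := by
  obtain ⟨hα, hδ⟩ := And.intro hA.isGDrazinInverse_gDrazinInv hD.isGDrazinInverse_gDrazinInv
  have hCα : C * gDrazinInv A = 0 := by
    refine hα.mul_eq_zero_of_intertwine hδ.quasinilpotent (lam := lam) ?_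
    rw [hδ.sub_sq_mul]
    exact hCA
  have hCα' (n : ℕ) (X : 𝒜) : X * C * gDrazinInv A ^ (n + 2) = 0 := by
    rw [pow_succ', ← mul_assoc, mul_assoc X, hCα, mul_zero, zero_mul]
  have key := isGDrazinInverse_block hα hδ hCA hAB hCB hCα
  refine ⟨⟨_, key⟩, ?_, ?_, ?_⟩
  · simpa only [hCα'] using summable_zero
  · simpa only [hCα', Finset.sum_const_zero] using summable_zero
  · simpa only [hCα', Finset.sum_const_zero, tsum_zero, add_zero] using key.gDrazinInv_matrix_eq
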